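/- Let $\mathbb{H}(n)$ be the real vector space of Hermitian complex $n\times n$ matrices and let $\mathbb{P}(n)\subset\mathbb{H}(n)$ be the open subset of positive definite matrices, regarded as a smooth manifold whose tangent space at every point is identified with $\mathbb{H}(n)$. For $\Sigma\in\mathbb{P}(n)$ and $H\in\mathbb{H}(n)$ let $\mathcal{L}_\Sigma(H)$ denote the unique complex $n\times n$ matrix $X$ with $\Sigma X+X\Sigma=H$. For $\Sigma,T\in\mathbb{P}(n)$ the number $\operatorname{tr}\Sigma+\operatorname{tr}T-2\operatorname{tr}\big((\Sigma^{1/2}T\Sigma^{1/2})^{1/2}\big)$ is real and nonnegative; let $$d^{BW}(\Sigma,T)=\Big[\operatorname{tr}\Sigma+\operatorname{tr}T-2\operatorname{tr}\big((\Sigma^{1/2}T\Sigma^{1/2})^{1/2}\big)\Big]^{1/2}$$ be the Bures–Wasserstein distance. Then $d^{BW}$ is a Riemannian distance, with the following corresponding metric: the formula $$\mathfrak{g}^{BW}_\Sigma(H,K)=\operatorname{Re}\operatorname{tr}\big(\mathcal{L}_\Sigma(H)\,\Sigma\,\mathcal{L}_\Sigma(K)\big)=\tfrac12\operatorname{Re}\operatorname{tr}\big(\mathcal{L}_\Sigma(H)\,K\big),\qquad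 \Sigma\in\mathbb{P}(n),\ H,K\in\mathbb{H}(n),$$ (in which the second equality always holds) defines a smooth Riemannian metric on $\mathbb{P}(n)$, and for all $\Sigma,T\in\mathbb{P}(n)$ the number $d^{BW}(\Sigma,T)$ is the infimum of the $\mathfrak{g}^{BW}$-lengths of the $C^1$ curves in $\mathbb{P}(n)$ from $\Sigma$ to $T$. -/

import Mathlib

open Bundle
open scoped Manifold ContDiff MatrixOrder ComplexOrder

noncomputable section

/-- The real vector space `ℍ(n)` of Hermitian complex `n × n` matrices. -/
def HermMat (n : ℕ) : Type :=
  selfAdjoint.submodule ℝ (Matrix (Fin n) (Fin n) ℂ)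

section Norm

attribute [local instance] Matrix.frobeniusNormedAddCommGroup Matrix.frobeniusNormedSpace

/-- The Frobenius norm on `ℍ(n)`. It serves only to make `ℍ(n)` a model space for manifolds;
its topology is the usual entrywise one. -/
instance HermMat.instNormedAddCommGroup (n : ℕ) : NormedAddCommGroup (HermMat n) :=
  inferInstanceAs (NormedAddCommGroup (selfAdjoint.submodule ℝ (Matrix (Fin n) (Fin n) ℂ)))

instance HermMat.instNormedSpace (n : ℕ) : NormedSpace ℝ (HermMat n) :=
  inferInstanceAs (NormedSpace ℝ (selfAdjoint.submodule ℝ (Matrix (Fin n) (Fin n) ℂ)))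

end Norm

/-- The inclusion of `ℍ(n)` into the complex `n × n` matrices. -/
def HermMat.toMat {n : ℕ} : HermMat n →ₗ[ℝ] Matrix (Fin n) (Fin n) ℂ :=
  (selfAdjoint.submodule ℝ (Matrix (Fin n) (Fin n) ℂ)).subtype

theorem HermMat.isHermitian {n : ℕ} (A : HermMat n) : (HermMat.toMat A).IsHermitian :=
  A.2

theorem HermMat.continuous_toMat (n : ℕ) :
    Continuous (HermMat.toMat : HermMat n → Matrix (Fin n) (Fin n) ℂ) :=
  continuous_subtype_val

theorem HermMat.isOpen_posDef (n : ℕ) :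
    IsOpen {A : HermMat n | (HermMat.toMat A).PosDef} := by
  have hset : {A : HermMat n | (HermMat.toMat A).PosDef} =
      {A : HermMat n | ∀ x ∈ Metric.sphere (0 : Fin n → ℂ) 1,
        0 < (star x ⬝ᵥ ((HermMat.toMat A).mulVec x)).re} := by
    ext A
    have hA : (HermMat.toMat A).IsHermitian := A.isHermitian
    simp only [Set.mem_ofPred_eq]
    constructor
    · intro h x hx
      have hx0 : x ≠ 0 := by
        rintro rfl
        simp at hx
      exact (Complex.pos_iff.1 (h.dotProduct_mulVec_pos hx0)).1
    · intro h
      refine Matrix.PosDef.of_dotProduct_mulVec_pos hA fun x hx => ?_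
      have him : (star x ⬝ᵥ ((HermMat.toMat A).mulVec x)).im = 0 := by
        simpa using hA.im_star_dotProduct_mulVec_self x
      refine Complex.pos_iff.2 ⟨?_, him.symm⟩
      have hn : (0 : ℝ) < ‖x‖ := norm_pos_iff.2 hx
      have h1 := h (((‖x‖⁻¹ : ℝ) : ℂ) • x) (by
        simp [norm_smul, hn.ne'])
      rw [star_smul, Matrix.mulVec_smul, smul_dotProduct, dotProduct_smul] at h1
      simp only [smul_eq_mul, Complex.star_def, Complex.conj_ofReal, Complex.re_ofReal_mul] at h1
      exact pos_of_mul_pos_right (pos_of_mul_pos_right h1 (inv_pos.2 hn).le) (inv_pos.2 hn).le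
  rw [hset, isOpen_iff_mem_nhds]
  intro A hA
  have hc : Continuous fun p : HermMat n × (Fin n → ℂ) =>
      (star p.2 ⬝ᵥ ((HermMat.toMat p.1).mulVec p.2)).re := by
    refine Complex.continuous_re.comp ?_
    refine Continuous.dotProduct (continuous_snd.star) ?_
    exact Continuous.matrix_mulVec ((HermMat.continuous_toMat n).comp continuous_fst) continuous_snd
  refine (isCompact_sphere (0 : Fin n → ℂ) 1).eventually_forall_of_forall_eventually ?_
  intro x hx
  exact hc.continuousAt.eventually (lt_mem_nhds (hA x hx))

/-- The manifold `ℙ(n)` of positive definite Hermitian matrices, an open subset of `ℍ(n)`. Its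
tangent space at every point is `ℍ(n)`. -/
def PosDefMat (n : ℕ) : TopologicalSpace.Opens (HermMat n) :=
  ⟨{A : HermMat n | (HermMat.toMat A).PosDef}, HermMat.isOpen_posDef n⟩

/-- The matrix underlying a point of `ℙ(n)`. -/
abbrev matOf {n : ℕ} (S : PosDefMat n) : Matrix (Fin n) (Fin n) ℂ :=
  HermMat.toMat (S : HermMat n)

/-- The Lyapunov operator `X ↦ Σ X + X Σ` on complex `n × n` matrices. -/
def lyapunovMap {n : ℕ} (S : PosDefMat n) :
    Matrix (Fin n) (Fin n) ℂ →ₗ[ℂ] Matrix (Fin n) (Fin n) ℂ :=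
  LinearMap.mulLeft ℂ (matOf S) + LinearMap.mulRight ℂ (matOf S)

theorem lyapunovMap_injective {n : ℕ} (S : PosDefMat n) :
    Function.Injective (lyapunovMap S) := by
  rw [injective_iff_map_eq_zero]
  intro X hX
  have hS : (matOf S).PosDef := S.2
  have hX' : (matOf S) * X + X * (matOf S) = 0 := hX
  have h1 := (hS.posSemidef.conjTranspose_mul_mul_same X).trace_nonneg
  have h2 := (hS.posSemidef.mul_mul_conjTranspose_same X).trace_nonneg
  have h3 : (X.conjTranspose * (matOf S) * X).trace + (X * (matOf S) * X.conjTranspose).trace = 0 := by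
    rw [Matrix.trace_mul_comm (X * (matOf S)), ← Matrix.trace_add, Matrix.mul_assoc, ← Matrix.mul_add,
      hX', Matrix.mul_zero, Matrix.trace_zero]
  have h4 : (X.conjTranspose * (matOf S) * X).trace = 0 :=
    ((add_eq_zero_iff_of_nonneg h1 h2).1 h3).1
  have h5 : X.conjTranspose * (matOf S) * X = 0 :=
    (hS.posSemidef.conjTranspose_mul_mul_same X).trace_eq_zero_iff.1 h4
  ext i j
  by_contra hne
  have hv : X.mulVec (Pi.single j 1) ≠ 0 := by
    intro h
    apply hne
    have := congrFun h i
    simpa using this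
  have hp := hS.dotProduct_mulVec_pos hv
  have h6 : star (X.mulVec (Pi.single j 1)) ⬝ᵥ ((matOf S).mulVec (X.mulVec (Pi.single j 1))) =
      star (Pi.single j (1 : ℂ)) ⬝ᵥ
        ((X.conjTranspose * (matOf S) * X).mulVec (Pi.single j 1)) := by
    simp only [Matrix.star_mulVec, Matrix.dotProduct_mulVec, Matrix.vecMul_vecMul, Matrix.mul_assoc]
  rw [h6, h5] at hp
  simp at hp

/-- `lyapunov S H` is the unique complex matrix `X` with `S X + X S = H`. -/
def lyapunov {n : ℕ} (S : PosDefMat n) :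
    Matrix (Fin n) (Fin n) ℂ →ₗ[ℂ] Matrix (Fin n) (Fin n) ℂ :=
  (LinearEquiv.ofInjectiveEndo (lyapunovMap S) (lyapunovMap_injective S)).symm.toLinearMap

/-- The complex number `tr Σ + tr T - 2 tr (Σ^{1/2} T Σ^{1/2})^{1/2}`, where `CFC.sqrt` is the
positive semidefinite square root of a positive semidefinite matrix. -/
def bwSq {n : ℕ} (S T : PosDefMat n) : ℂ :=
  (matOf S).trace + (matOf T).trace -
    2 * (CFC.sqrt (CFC.sqrt (matOf S) * matOf T * CFC.sqrt (matOf S))).trace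

/-- The Bures-Wasserstein distance, the square root of the (real and nonnegative) number
`bwSq S T`. -/
def bwDist {n : ℕ} (S T : PosDefMat n) : ℝ :=
  Real.sqrt (bwSq S T).re

/-- The Riemannian distance, in `[0, ∞]`, of a smooth Riemannian metric `g` on `ℙ(n)`: the infimum
of the `g`-lengths of the `C^1` curves joining the two points. -/
def riemDist {n : ℕ}
    (g : ContMDiffRiemannianMetric 𝓘(ℝ, HermMat n) ∞ (HermMat n)
      (fun S : PosDefMat n => TangentSpace 𝓘(ℝ, HermMat n) S))
    (S T : PosDefMat n) : ENNReal :=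
  letI : RiemannianBundle (fun S : PosDefMat n => TangentSpace 𝓘(ℝ, HermMat n) S) :=
    ⟨g.toRiemannianMetric⟩
  Manifold.riemannianEDist 𝓘(ℝ, HermMat n) S T

end

noncomputable section

/-! ### Hermitian matrices, the anticommutator and weighted trace forms -/

namespace HermMat

variable {n : ℕ}

/-! Everything rests on the positive definite matrix `N = transport S T` with `N T N = S`. With `U =
1 - N`, the squared distance becomes `tr (U T U)` (`bwSq_eq_trace`), a squared seminorm for the form
`weightedTrace T`; the metric at `T` is the same form evaluated on Lyapunov solutions
(`bwForm_eq_weightedTrace`).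

Lower bound: the derivative of `T ↦ d(S, T)²` is `H ↦ Re tr (U H)` (`hasFDerivAt_distSq`). Writing
`H = T V + V T` turns this into twice the form at `(U, V)`, so Cauchy-Schwarz bounds it by `2 d(S,
T)` times the norm of `H` (`abs_reTr_le`). Hence `d(S, ·)` grows along a curve no faster than its
length.

Upper bound: the curve `A T A` with `A = (1 - t) N + t` runs from `S` to `T`. Its velocity has
Lyapunov solution `A⁻¹ U`, so its squared speed is constantly `tr (U T U)` and its length is exactly
the distance (`bwForm_congruenceVelocity`). -/

instance instFiniteDimensional (n : ℕ) : FiniteDimensional ℝ (HermMat n) :=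
  inferInstanceAs (FiniteDimensional ℝ (selfAdjoint.submodule ℝ (Matrix (Fin n) (Fin n) ℂ)))

instance instCompleteSpace (n : ℕ) : CompleteSpace (HermMat n) :=
  FiniteDimensional.complete ℝ (HermMat n)

/-- A Hermitian matrix as an element of `ℍ(n)`. -/
def ofMat (A : Matrix (Fin n) (Fin n) ℂ) (hA : A.IsHermitian) : HermMat n :=
  ⟨A, hA⟩

@[simp]
theorem toMat_ofMat (A : Matrix (Fin n) (Fin n) ℂ) (hA : A.IsHermitian) :
    toMat (ofMat A hA) = A :=
  rfl

theorem toMat_injective : Function.Injective (toMat : HermMat n → Matrix (Fin n) (Fin n) ℂ) :=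
  Subtype.val_injective

@[simp]
theorem conjTranspose_toMat (A : HermMat n) : (toMat A).conjTranspose = toMat A :=
  A.isHermitian

/-- The bilinear map `(A, H) ↦ A H + H A` on `ℍ(n)`. -/
def anticomm (n : ℕ) : HermMat n →L[ℝ] HermMat n →L[ℝ] HermMat n :=
  LinearMap.toContinuousBilinearMap <|
    LinearMap.mk₂ ℝ
      (fun A H : HermMat n => ofMat (toMat A * toMat H + toMat H * toMat A) (by
        simp [Matrix.IsHermitian, add_comm]))
      (fun A B H => toMat_injective (by
        change (toMat A + toMat B) * toMat H + toMat H * (toMat A + toMat B) =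
          (toMat A * toMat H + toMat H * toMat A) + (toMat B * toMat H + toMat H * toMat B)
        noncomm_ring))
      (fun c A H => toMat_injective (by
        change (c • toMat A) * toMat H + toMat H * (c • toMat A) =
          c • (toMat A * toMat H + toMat H * toMat A)
        simp))
      (fun A H K => toMat_injective (by
        change toMat A * (toMat H + toMat K) + (toMat H + toMat K) * toMat A =
          (toMat A * toMat H + toMat H * toMat A) + (toMat A * toMat K + toMat K * toMat A)
        noncomm_ring))
      (fun c A H => toMat_injective (by
        change toMat A * (c • toMat H) + (c • toMat H) * toMat A =
          c • (toMat A * toMat H + toMat H * toMat A)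
        simp))

@[simp]
theorem toMat_anticomm (A H : HermMat n) :
    toMat (anticomm n A H) = toMat A * toMat H + toMat H * toMat A :=
  rfl

theorem anticomm_comm (A H : HermMat n) : anticomm n A H = anticomm n H A :=
  toMat_injective (by simp [add_comm])

/-- The real linear functional `H ↦ Re tr (U H)` on `ℍ(n)`. -/
def reTr (U : Matrix (Fin n) (Fin n) ℂ) : HermMat n →L[ℝ] ℝ :=
  LinearMap.toContinuousLinearMap
    { toFun := fun H => (U * toMat H).trace.re
      map_add' := by simp [mul_add]
      map_smul' := by simp }

theorem reTr_apply (U : Matrix (Fin n) (Fin n) ℂ) (H : HermMat n) :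
    reTr U H = (U * toMat H).trace.re :=
  rfl

/-- The linear map `H ↦ U H U*` on `ℍ(n)`. -/
def congruence (U : Matrix (Fin n) (Fin n) ℂ) : HermMat n →L[ℝ] HermMat n :=
  LinearMap.toContinuousLinearMap
    { toFun := fun H => ofMat (U * toMat H * U.conjTranspose)
        (Matrix.isHermitian_mul_mul_conjTranspose U H.isHermitian)
      map_add' := fun _ _ => toMat_injective (by simp [mul_add, add_mul])
      map_smul' := fun _ _ => toMat_injective (by simp) }

@[simp]
theorem toMat_congruence (U : Matrix (Fin n) (Fin n) ℂ) (H : HermMat n) :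
    toMat (congruence U H) = U * toMat H * U.conjTranspose :=
  rfl

/-- The bilinear form `(U, V) ↦ Re tr (U S V)` on `ℍ(n)`. -/
def weightedTrace (S : HermMat n) : LinearMap.BilinForm ℝ (HermMat n) :=
  LinearMap.mk₂ ℝ (fun U V : HermMat n => (toMat U * toMat S * toMat V).trace.re)
    (by simp [add_mul]) (by simp) (by simp [mul_add]) (by simp)

theorem weightedTrace_apply (S U V : HermMat n) :
    weightedTrace S U V = (toMat U * toMat S * toMat V).trace.re :=
  rfl

theorem weightedTrace_comm (S U V : HermMat n) : weightedTrace S U V = weightedTrace S V U := by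
  have h : (toMat U * toMat S * toMat V).conjTranspose = toMat V * toMat S * toMat U := by
    simp [mul_assoc]
  rw [weightedTrace_apply, weightedTrace_apply, ← h, Matrix.trace_conjTranspose]
  simp

theorem weightedTrace_self_nonneg {S : HermMat n} (hS : (toMat S).PosDef) (U : HermMat n) :
    0 ≤ weightedTrace S U U := by
  have h := (hS.posSemidef.conjTranspose_mul_mul_same (toMat U)).trace_nonneg
  rw [conjTranspose_toMat] at h
  exact (Complex.nonneg_iff.1 h).1

/-- A positive semidefinite matrix of trace zero vanishes, and `U S U` is the Gram matrix of
`S^{1/2} U`; so a zero value forces `S^{1/2} U = 0`, and `S` is invertible. -/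
theorem weightedTrace_self_pos {S : HermMat n} (hS : (toMat S).PosDef) {U : HermMat n}
    (hU : U ≠ 0) : 0 < weightedTrace S U U := by
  have hpsd := hS.posSemidef.conjTranspose_mul_mul_same (toMat U)
  rw [conjTranspose_toMat] at hpsd
  refine (weightedTrace_self_nonneg hS U).lt_of_ne fun h => hU ?_
  have h0 : toMat U * toMat S * toMat U = 0 := by
    refine hpsd.trace_eq_zero_iff.1 (Complex.ext h.symm ?_)
    exact (Complex.nonneg_iff.1 hpsd.trace_nonneg).2.symm
  have hroot : CFC.sqrt (toMat S) * CFC.sqrt (toMat S) = toMat S :=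
    CFC.sqrt_mul_sqrt_self _ (Matrix.nonneg_iff_posSemidef.2 hS.posSemidef)
  have hsa : (CFC.sqrt (toMat S)).conjTranspose = CFC.sqrt (toMat S) :=
    (Matrix.nonneg_iff_posSemidef.1 (CFC.sqrt_nonneg _)).isHermitian
  have h1 : CFC.sqrt (toMat S) * toMat U = 0 := by
    rw [← Matrix.conjTranspose_mul_self_eq_zero, Matrix.conjTranspose_mul, hsa,
      conjTranspose_toMat, mul_assoc, ← mul_assoc (CFC.sqrt _), hroot, ← mul_assoc, h0]
  apply toMat_injective
  rw [map_zero, ← hS.isUnit.mul_right_eq_zero, ← hroot, mul_assoc, h1, mul_zero]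

/-- `Re tr (U (S V + V S)) = 2 Re tr (U S V)` for Hermitian matrices. -/
theorem reTr_anticomm (S U V : HermMat n) :
    reTr (toMat U) (anticomm n S V) = 2 * weightedTrace S U V := by
  rw [reTr_apply, toMat_anticomm, mul_add, Matrix.trace_add, Complex.add_re, ← mul_assoc,
    ← weightedTrace_apply, Matrix.trace_mul_comm, ← weightedTrace_apply, weightedTrace_comm S V U,
    two_mul]

/-- Cauchy-Schwarz, the inequality behind the lower bound on lengths. -/
theorem weightedTrace_sq_le {S : HermMat n} (hS : (toMat S).PosDef) (U V : HermMat n) :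
    weightedTrace S U V ^ 2 ≤ weightedTrace S U U * weightedTrace S V V :=
  (weightedTrace S).apply_sq_le_of_symm (weightedTrace_self_nonneg hS)
    ⟨fun U V => by simpa using weightedTrace_comm S U V⟩ U V

/-- For positive definite `S`, the map `H ↦ S H + H S` is an automorphism of `ℍ(n)`. -/
theorem exists_equiv_anticomm {S : HermMat n} (hS : (toMat S).PosDef) :
    ∃ e : HermMat n ≃L[ℝ] HermMat n, (e : HermMat n →L[ℝ] HermMat n) = anticomm n S := by
  have hinj : Function.Injective (anticomm n S : HermMat n →ₗ[ℝ] HermMat n) := by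
    rw [injective_iff_map_eq_zero]
    intro X hX
    by_contra hne
    have h1 := reTr_anticomm S X X
    have h2 := weightedTrace_self_pos hS hne
    have hX' : anticomm n S X = 0 := hX
    rw [hX', map_zero] at h1
    linarith
  refine ⟨(LinearEquiv.ofInjectiveEndo _ hinj).toContinuousLinearEquiv, ?_⟩
  ext X
  rfl

end HermMat

open HermMat

variable {n : ℕ}

/-! ### The Lyapunov equation and smoothness of its solution operator -/

theorem lyapunov_spec (S : PosDefMat n) (H : Matrix (Fin n) (Fin n) ℂ) :
    matOf S * lyapunov S H + lyapunov S H * matOf S = H :=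
  (LinearEquiv.ofInjectiveEndo (lyapunovMap S) (lyapunovMap_injective S)).apply_symm_apply H

/-- The Lyapunov solution operator of a positive definite matrix on `ℍ(n)`. -/
def HermMat.solve (S : HermMat n) : HermMat n →L[ℝ] HermMat n :=
  (anticomm n S).inverse

theorem HermMat.anticomm_solve {S : HermMat n} (hS : (toMat S).PosDef) (H : HermMat n) :
    anticomm n S (solve S H) = H := by
  obtain ⟨e, he⟩ := exists_equiv_anticomm hS
  rw [solve, ← he, ContinuousLinearMap.inverse_equiv]
  exact e.apply_symm_apply H

theorem HermMat.solve_anticomm {S : HermMat n} (hS : (toMat S).PosDef) (H : HermMat n) :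
    solve S (anticomm n S H) = H := by
  obtain ⟨e, he⟩ := exists_equiv_anticomm hS
  rw [solve, ← he, ContinuousLinearMap.inverse_equiv]
  exact e.symm_apply_apply H

/-- Inversion of continuous linear maps is smooth at an invertible map, and `S ↦ anticomm n S` is
linear. This is what makes the metric smooth. -/
theorem HermMat.contDiffAt_solve {S : HermMat n} (hS : (toMat S).PosDef) {k : WithTop ℕ∞} :
    ContDiffAt ℝ k (solve : HermMat n → HermMat n →L[ℝ] HermMat n) S := by
  obtain ⟨e, he⟩ := exists_equiv_anticomm hS
  have h := contDiffAt_map_inverse (n := k) e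
  rw [he] at h
  exact h.comp S (anticomm n).contDiff.contDiffAt

/-- The Hermitian solution is also a complex solution, and the latter is unique. -/
theorem lyapunov_toMat (S : PosDefMat n) (H : HermMat n) :
    lyapunov S (toMat H) = toMat (solve (S : HermMat n) H) := by
  apply lyapunovMap_injective S
  refine (lyapunov_spec S _).trans ?_
  conv_lhs => rw [← anticomm_solve S.2 H]
  rfl

/-! ### The square root and its derivative -/

namespace HermMat

/-- The positive semidefinite square root on `ℍ(n)` (zero off the positive semidefinite cone). -/
def root (A : HermMat n) : HermMat n :=
  ofMat (CFC.sqrt (toMat A)) (Matrix.nonneg_iff_posSemidef.1 (CFC.sqrt_nonneg _)).isHermitian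

theorem toMat_root (A : HermMat n) : toMat (root A) = CFC.sqrt (toMat A) :=
  rfl

theorem root_mul_root {A : HermMat n} (hA : (toMat A).PosDef) :
    toMat (root A) * toMat (root A) = toMat A :=
  CFC.sqrt_mul_sqrt_self _ (Matrix.nonneg_iff_posSemidef.2 hA.posSemidef)

theorem root_unique {A B : HermMat n} (hB : (toMat B).PosDef)
    (h : toMat B * toMat B = toMat A) : root A = B :=
  toMat_injective (CFC.sqrt_unique h (Matrix.nonneg_iff_posSemidef.2 hB.posSemidef))

theorem posDef_root {A : HermMat n} (hA : (toMat A).PosDef) : (toMat (root A)).PosDef :=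
  Matrix.isStrictlyPositive_iff_posDef.1
    (IsStrictlyPositive.sqrt _ (Matrix.isStrictlyPositive_iff_posDef.2 hA))

theorem posDef_congruence {A : HermMat n} (hA : (toMat A).PosDef)
    {U : Matrix (Fin n) (Fin n) ℂ} (hU : IsUnit U) : (toMat (congruence U A)).PosDef := by
  have h := (Matrix.IsUnit.posDef_star_right_conjugate_iff hU).2 hA
  exact h

/-- The square root is smooth on positive definite matrices, and its derivative solves the
Lyapunov equation. -/
theorem root_contDiffAt_and_hasFDerivAt {Q : HermMat n} (hQ : (toMat Q).PosDef) :
    ContDiffAt ℝ 1 root Q ∧ HasFDerivAt root (solve (root Q)) Q := by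
  set A := root Q with hA
  have hApos : (toMat A).PosDef := posDef_root hQ
  obtain ⟨e, he⟩ := exists_equiv_anticomm hApos
  -- Squaring, written through the bilinear anticommutator so that it stays in `ℍ(n)`; its
  -- derivative at `A` is `X ↦ A X + X A`, which is invertible, so the inverse function theorem
  -- applies.
  let sq : HermMat n → HermMat n := fun B => (1 / 2 : ℝ) • anticomm n B B
  have sq_mat (B : HermMat n) : toMat (sq B) = toMat B * toMat B := by
    simp only [sq, map_smul, toMat_anticomm, ← two_smul ℝ (toMat B * toMat B), smul_smul]
    norm_num
  have hsqA : sq A = Q := toMat_injective ((sq_mat A).trans (root_mul_root hQ))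
  have hcd : ContDiffAt ℝ 1 sq A :=
    (((anticomm n).contDiff.clm_apply contDiff_id).const_smul (1 / 2 : ℝ)).contDiffAt
  have hfd : HasFDerivAt sq (e : HermMat n →L[ℝ] HermMat n) A := by
    have h := (((anticomm n).hasFDerivAt (x := A)).clm_apply (hasFDerivAt_id A)).const_smul
      (1 / 2 : ℝ)
    refine h.congr_fderiv ?_
    rw [he]
    ext1 X
    have : anticomm n X A = anticomm n A X := anticomm_comm X A
    simp only [smul_add, this, FunLike.coe_smul, Pi.smul_apply, ContinuousLinearMap.comp_id, id,
      add_apply, ContinuousLinearMap.flip_apply]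
    rw [← add_smul]
    norm_num
  have hst : HasStrictFDerivAt sq (e : HermMat n →L[ℝ] HermMat n) A :=
    hcd.hasStrictFDerivAt' hfd one_ne_zero
  let inv := hst.localInverse sq e A
  -- Near `Q` the local inverse stays close to `A`, hence positive definite, so uniqueness of the
  -- square root identifies it with `root`.
  have hinv : root =ᶠ[nhds Q] inv := by
    have h1 := hst.eventually_right_inverse
    have h2 := hst.localInverse_tendsto.eventually ((isOpen_posDef n).mem_nhds hApos)
    rw [hsqA] at h1 h2
    filter_upwards [h1, h2] with Y hY hpos
    exact root_unique hpos ((sq_mat _).symm.trans (congrArg toMat hY))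
  have hc : ContDiffAt ℝ 1 inv (sq A) := hcd.to_localInverse hfd one_ne_zero
  have hd : HasFDerivAt inv (e.symm : HermMat n →L[ℝ] HermMat n) (sq A) :=
    hst.to_localInverse.hasFDerivAt
  rw [hsqA] at hc hd
  refine ⟨hc.congr_of_eventuallyEq hinv, (hd.congr_of_eventuallyEq hinv).congr_fderiv ?_⟩
  rw [solve, ← he, ContinuousLinearMap.inverse_equiv]

/-! ### The transport matrix and the squared distance as a quadratic form -/

/-- The positive definite matrix `N` with `N T N = S`. -/
def transport (S T : HermMat n) : HermMat n :=
  congruence (toMat (root S))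
    (ofMat (toMat (root (congruence (toMat (root S)) T)))⁻¹ (root _).isHermitian.inv)

theorem toMat_transport (S T : HermMat n) :
    toMat (transport S T) = toMat (root S) *
      (toMat (root (congruence (toMat (root S)) T)))⁻¹ * toMat (root S) := by
  simp [transport]

variable {S T : HermMat n}

theorem posDef_transport (hS : (toMat S).PosDef) (hT : (toMat T).PosDef) :
    (toMat (transport S T)).PosDef :=
  posDef_congruence (posDef_root (posDef_congruence hT (posDef_root hS).isUnit)).inv
    (posDef_root hS).isUnit

/-- With `R = S^{1/2}` and `A² = R T R`, one has `N = R A⁻¹ R`, and the inner `R T R` cancels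
against the two factors `A⁻¹`. -/
theorem transport_mul_mul_transport (hS : (toMat S).PosDef) (hT : (toMat T).PosDef) :
    toMat (transport S T) * toMat T * toMat (transport S T) = toMat S := by
  have hQ := posDef_congruence hT (posDef_root hS).isUnit
  have hAA := root_mul_root hQ
  have hA := (posDef_root hQ).isUnit
  rw [toMat_transport]
  set A := toMat (root (congruence (toMat (root S)) T))
  set R := toMat (root S) with hR
  have hdet := (Matrix.isUnit_iff_isUnit_det A).1 hA
  rw [toMat_congruence, conjTranspose_toMat, ← hR] at hAA
  calc R * A⁻¹ * R * toMat T * (R * A⁻¹ * R) = R * A⁻¹ * (R * toMat T * R) * A⁻¹ * R := by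
        simp only [mul_assoc]
    _ = R * (A⁻¹ * A) * (A * A⁻¹) * R := by rw [← hAA]; simp only [mul_assoc]
    _ = toMat S := by
        rw [Matrix.nonsing_inv_mul _ hdet, Matrix.mul_nonsing_inv _ hdet, mul_one, mul_one,
          root_mul_root hS]

/-- By cyclicity, `tr (R A⁻¹ R T) = tr (A⁻¹ R T R) = tr (A⁻¹ A²)`. -/
theorem trace_root_congruence (hS : (toMat S).PosDef) (hT : (toMat T).PosDef) :
    (toMat (root (congruence (toMat (root S)) T))).trace =
      (toMat (transport S T) * toMat T).trace := by
  have hQ := posDef_congruence hT (posDef_root hS).isUnit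
  have hAA := root_mul_root hQ
  have hA := (posDef_root hQ).isUnit
  rw [toMat_transport]
  set A := toMat (root (congruence (toMat (root S)) T))
  set R := toMat (root S) with hR
  have hdet := (Matrix.isUnit_iff_isUnit_det A).1 hA
  rw [toMat_congruence, conjTranspose_toMat, ← hR] at hAA
  rw [mul_assoc, mul_assoc, Matrix.trace_mul_comm, mul_assoc, ← hAA, ← mul_assoc,
    Matrix.nonsing_inv_mul _ hdet, one_mul]

/-- The identity matrix as an element of `ℍ(n)`. -/
def idMat (n : ℕ) : HermMat n :=
  ofMat 1 Matrix.isHermitian_one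

@[simp]
theorem toMat_idMat : toMat (idMat n) = 1 :=
  rfl

theorem bwSq_eq_trace_root (S T : PosDefMat n) :
    bwSq S T = (matOf S).trace + (matOf T).trace -
      2 * (toMat (root (congruence (toMat (root (S : HermMat n))) T))).trace := by
  rw [bwSq, toMat_root, toMat_congruence, conjTranspose_toMat, toMat_root]

/-- Expanding the right side gives `tr (N T N) + tr T - 2 tr (N T)`, whose first term is `tr S`. -/
theorem bwSq_eq_trace (S T : PosDefMat n) :
    bwSq S T = (toMat (idMat n - transport (S : HermMat n) T) * matOf T *
      toMat (idMat n - transport (S : HermMat n) T)).trace := by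
  rw [bwSq_eq_trace_root, trace_root_congruence S.2 T.2]
  have hS : matOf S = _ := (transport_mul_mul_transport S.2 T.2).symm
  rw [hS, map_sub, toMat_idMat, two_mul]
  set N := toMat (transport (S : HermMat n) T)
  have h : (1 - N) * matOf T * (1 - N) =
      N * matOf T * N + matOf T - (N * matOf T + matOf T * N) := by noncomm_ring
  rw [h, Matrix.trace_sub, Matrix.trace_add, Matrix.trace_add, Matrix.trace_mul_comm (matOf T) N]

theorem bwSq_re_eq_weightedTrace (S T : PosDefMat n) :
    (bwSq S T).re = weightedTrace (T : HermMat n) (idMat n - transport (S : HermMat n) T)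
      (idMat n - transport (S : HermMat n) T) := by
  rw [bwSq_eq_trace, weightedTrace_apply]

theorem bwSq_nonneg (S T : PosDefMat n) : 0 ≤ bwSq S T := by
  have h := (T.2.posSemidef.conjTranspose_mul_mul_same
    (toMat (idMat n - transport (S : HermMat n) T))).trace_nonneg
  rwa [conjTranspose_toMat, ← bwSq_eq_trace] at h

theorem bwSq_self (S : PosDefMat n) : bwSq S S = 0 := by
  have h : root (congruence (toMat (root (S : HermMat n))) S) = (S : HermMat n) := by
    refine root_unique S.2 ?_
    rw [toMat_congruence, conjTranspose_toMat, ← root_mul_root S.2]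
    simp only [mul_assoc]
  rw [bwSq_eq_trace_root, h]
  ring

/-! ### Differentiating the squared distance -/

/-- The function `T ↦ d(S, T)²` on `ℍ(n)`. -/
def distSq (S T : HermMat n) : ℝ :=
  reTr 1 S + reTr 1 T - 2 * reTr 1 (root (congruence (toMat (root S)) T))

theorem distSq_eq (S T : PosDefMat n) : distSq (S : HermMat n) T = (bwSq S T).re := by
  rw [bwSq_eq_trace_root, distSq]
  simp [reTr_apply]

/-- Multiply `A X + X A = K` by `A⁻¹` and take traces. This gives the derivative of the trace of the
square root. -/
theorem two_mul_reTr_solve {A : HermMat n} (hA : (toMat A).PosDef) (K : HermMat n) :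
    2 * reTr 1 (solve A K) = reTr (toMat A)⁻¹ K := by
  have hdet := (Matrix.isUnit_iff_isUnit_det _).1 hA.isUnit
  conv_rhs => rw [← anticomm_solve hA K]
  rw [reTr_apply, reTr_apply, toMat_anticomm, mul_add, Matrix.trace_add, ← mul_assoc,
    Matrix.nonsing_inv_mul _ hdet, ← mul_assoc, Matrix.trace_mul_comm _ (toMat A), ← mul_assoc,
    Matrix.mul_nonsing_inv _ hdet, Complex.add_re, two_mul]

theorem contDiffAt_distSq (hS : (toMat S).PosDef) (hT : (toMat T).PosDef) :
    ContDiffAt ℝ 1 (distSq S) T := by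
  have h := (root_contDiffAt_and_hasFDerivAt
    (posDef_congruence hT (posDef_root hS).isUnit)).1
  have h2 : ContDiffAt ℝ 1 (fun T => root (congruence (toMat (root S)) T)) T :=
    h.comp T (congruence _).contDiff.contDiffAt
  have h3 : ContDiffAt ℝ 1 (fun T => reTr 1 (root (congruence (toMat (root S)) T))) T :=
    (reTr 1).contDiff.contDiffAt.comp T h2
  exact (contDiffAt_const.add (reTr 1).contDiff.contDiffAt).sub (contDiffAt_const.mul h3)

/-- The root term contributes `-tr (A⁻¹ R H R) = -tr (N H)`, with `R = S^{1/2}` and `A² = R T R`. -/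
theorem hasFDerivAt_distSq (hS : (toMat S).PosDef) (hT : (toMat T).PosDef) :
    HasFDerivAt (distSq S) (reTr (toMat (idMat n - transport S T))) T := by
  have hQ := posDef_congruence hT (posDef_root hS).isUnit
  have h := (root_contDiffAt_and_hasFDerivAt hQ).2
  have h2 := h.comp T (congruence (toMat (root S))).hasFDerivAt
  have h3 := (reTr 1).hasFDerivAt.comp T h2
  have h4 := ((reTr 1).hasFDerivAt (x := T)).const_add (reTr 1 S) |>.sub (h3.const_mul 2)
  refine HasFDerivAt.congr_fderiv (f := distSq S) h4 ?_
  ext1 H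
  have h5 := two_mul_reTr_solve (posDef_root hQ) (congruence (toMat (root S)) H)
  simp only [sub_apply, smul_apply,
    ContinuousLinearMap.comp_apply, smul_eq_mul, h5]
  rw [map_sub, toMat_idMat, toMat_transport]
  simp only [reTr_apply, toMat_congruence, conjTranspose_toMat, sub_mul, Matrix.trace_sub,
    Complex.sub_re]
  rw [← mul_assoc, Matrix.trace_mul_comm _ (toMat (root S))]
  simp only [mul_assoc]

/-- The derivative of `T ↦ d(S, T)²` is at most `2 d(S, T)` times the Bures-Wasserstein norm. -/
theorem abs_reTr_le (S T : PosDefMat n) (H : HermMat n) :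
    |reTr (toMat (idMat n - transport (S : HermMat n) T)) H| ≤
      2 * (√(distSq (S : HermMat n) T) *
        √(weightedTrace (T : HermMat n) (solve (T : HermMat n) H) (solve (T : HermMat n) H))) := by
  have h := weightedTrace_sq_le T.2 (idMat n - transport (S : HermMat n) T)
    (solve (T : HermMat n) H)
  rw [← bwSq_re_eq_weightedTrace, ← distSq_eq] at h
  -- Substituting `H = T V + V T` turns the derivative into twice the form to which Cauchy-Schwarz
  -- was applied.
  conv_lhs => rw [← anticomm_solve T.2 H]
  rw [reTr_anticomm, abs_mul, abs_two, ← Real.sqrt_mul' _ (weightedTrace_self_nonneg T.2 _)]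
  gcongr
  exact Real.abs_le_sqrt h

theorem distSq_nonneg (S T : PosDefMat n) : 0 ≤ distSq (S : HermMat n) T := by
  rw [distSq_eq]
  exact (Complex.nonneg_iff.1 (bwSq_nonneg S T)).1

end HermMat

/-! ### Tangent bundle of an open subset of a normed space -/

section OpenSubset

theorem mem_chart_source_opens {E : Type*} [TopologicalSpace E] (U : TopologicalSpace.Opens E)
    (x y : U) : y ∈ (chartAt E x).source := by
  rw [TopologicalSpace.Opens.chartAt_eq, OpenPartialHomeomorph.subtypeRestr_source]
  exact Set.mem_univ _

variable {E : Type*} [NormedAddCommGroup E] [NormedSpace ℝ E] (U : TopologicalSpace.Opens E)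

/-- All preferred charts are the same restriction of the identity, whatever the base point. -/
theorem tangentBundleCore_coordChange_opens (x y z : U) :
    (tangentBundleCore 𝓘(ℝ, E) U).coordChange (achart E x) (achart E y) z =
      ContinuousLinearMap.id ℝ E := by
  ext v
  have h : achart E y = achart E x := Subtype.ext rfl
  rw [h]
  exact (tangentBundleCore 𝓘(ℝ, E) U).coordChange_self (achart E x) z (mem_chart_source_opens U x z) v

theorem symmL_tangentBundle_opens (x y : U) :
    (trivializationAt E (TangentSpace 𝓘(ℝ, E)) x).symmL ℝ y =
      ContinuousLinearMap.id ℝ E := by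
  rw [TangentBundle.symmL_trivializationAt_eq_core (mem_chart_source_opens U x y),
    tangentBundleCore_coordChange_opens]

/-- Over an open subset of a normed space, a field of bilinear forms on the tangent spaces is
smooth as soon as it is smooth as a map to the fixed space of bilinear forms. -/
theorem contMDiff_bilinearForm_opens {k : WithTop ℕ∞}
    (f : ∀ x : U, TangentSpace 𝓘(ℝ, E) x →L[ℝ] TangentSpace 𝓘(ℝ, E) x →L[ℝ] ℝ)
    (f' : U → E →L[ℝ] E →L[ℝ] ℝ) (hff' : ∀ x (v w : E), f x v w = f' x v w)
    (hf : ContMDiff 𝓘(ℝ, E) 𝓘(ℝ, E →L[ℝ] E →L[ℝ] ℝ) k f') :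
    ContMDiff 𝓘(ℝ, E) (𝓘(ℝ, E).prod 𝓘(ℝ, E →L[ℝ] E →L[ℝ] ℝ)) k
      (fun x : U => TotalSpace.mk' (E →L[ℝ] E →L[ℝ] ℝ) x (f x)) := by
  intro x
  rw [contMDiffAt_section]
  convert! hf x using 1
  ext y v w
  have hmem : y ∈ (trivializationAt E (TangentSpace 𝓘(ℝ, E)) x).baseSet :=
    mem_chart_source_opens U x y
  have h1 : (trivializationAt E (TangentSpace 𝓘(ℝ, E)) x).symmL ℝ y =
      ContinuousLinearMap.id ℝ E := symmL_tangentBundle_opens U x y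
  have hv (v : E) : (trivializationAt E (TangentSpace 𝓘(ℝ, E)) x).symm y v = v := by
    have h2 := DFunLike.congr_fun h1 v
    rwa [Trivialization.symmL_apply _ hmem] at h2
  simp only [hom_trivializationAt_apply]
  rw [inCoordinates_apply_eq₂ hmem hmem (Set.mem_univ _)]
  rw [hv v, hv w]
  simp [hff' y v w]

theorem hasMFDerivAt_subtype_val_opens (x : U) :
    HasMFDerivAt 𝓘(ℝ, E) 𝓘(ℝ, E) (Subtype.val : U → E) x (ContinuousLinearMap.id ℝ E) := by
  refine ⟨continuous_subtype_val.continuousAt, ?_⟩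
  have h := U.chartAt_subtype_val_symm_eventuallyEq (H := E) (x := x)
  have h2 : writtenInExtChartAt 𝓘(ℝ, E) 𝓘(ℝ, E) x (Subtype.val : U → E) =ᶠ[nhds (x : E)]
      fun y => y := by
    filter_upwards [h] with y hy
    exact hy.symm
  exact ((hasFDerivAt_id (x : E)).congr_of_eventuallyEq h2).hasFDerivWithinAt

end OpenSubset

/-- On a finite-dimensional space, the unit ball of a positive definite bilinear form is bounded. -/
theorem isVonNBounded_of_bilinear_pos {E : Type*} [NormedAddCommGroup E] [NormedSpace ℝ E]
    [FiniteDimensional ℝ E] (B : E →L[ℝ] E →L[ℝ] ℝ) (hB : ∀ v, v ≠ 0 → 0 < B v v) :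
    Bornology.IsVonNBounded ℝ {v : E | B v v < 1} := by
  have : ProperSpace E := FiniteDimensional.proper ℝ E
  rw [NormedSpace.isVonNBounded_iff]
  rcases subsingleton_or_nontrivial E with h | h
  · exact (Set.toFinite _).isBounded
  have hcont : Continuous fun v : E => B v v := B.continuous.clm_apply continuous_id
  -- The minimum of `B v v` on the unit sphere is the coercivity constant.
  obtain ⟨u, hu, hmin⟩ := (isCompact_sphere (0 : E) 1).exists_isMinOn
    (NormedSpace.sphere_nonempty.2 zero_le_one) hcont.continuousOn
  have hu0 : u ≠ 0 := by
    rintro rfl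
    simp at hu
  have hc := hB u hu0
  have hbound (v : E) : B u u * ‖v‖ ^ 2 ≤ B v v := by
    rcases eq_or_ne v 0 with rfl | hv
    · simp
    have hv' : ‖v‖ ≠ 0 := norm_ne_zero_iff.2 hv
    have h1 : B u u ≤ B (‖v‖⁻¹ • v) (‖v‖⁻¹ • v) :=
      hmin (show ‖v‖⁻¹ • v ∈ Metric.sphere (0 : E) 1 by simp [norm_smul, hv'])
    simp only [map_smul, smul_apply, smul_eq_mul] at h1
    calc B u u * ‖v‖ ^ 2 ≤ (‖v‖⁻¹ * (‖v‖⁻¹ * B v v)) * ‖v‖ ^ 2 := by gcongr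
      _ = B v v := by field_simp
  refine (Metric.isBounded_closedBall (x := (0 : E)) (r := √(1 / B u u))).subset fun v hv => ?_
  rw [mem_closedBall_zero_iff]
  refine Real.le_sqrt_of_sq_le ?_
  rw [le_div_iff₀ hc, mul_comm]
  have hv1 : B v v < 1 := hv
  exact (hbound v).trans hv1.le

/-! ### The Bures-Wasserstein metric -/

namespace HermMat

/-- The bilinear form `(H, K) ↦ ½ Re tr (H K)` on `ℍ(n)`. -/
def halfTrace (n : ℕ) : HermMat n →L[ℝ] HermMat n →L[ℝ] ℝ :=
  LinearMap.toContinuousBilinearMap <|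
    LinearMap.mk₂ ℝ (fun H K : HermMat n => 1 / 2 * reTr (toMat H) K)
      (fun _ _ _ => by simp [reTr_apply, add_mul, mul_add])
      (fun _ _ _ => by simp [reTr_apply]; ring)
      (fun _ _ _ => by simp [mul_add])
      (fun _ _ _ => by simp; ring)

/-- The Bures-Wasserstein bilinear form at `S`. -/
def bwForm (S : HermMat n) : HermMat n →L[ℝ] HermMat n →L[ℝ] ℝ :=
  (halfTrace n).comp (solve S)

theorem bwForm_apply (S H K : HermMat n) :
    bwForm S H K = 1 / 2 * reTr (toMat (solve S H)) K :=
  rfl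

theorem bwForm_eq_weightedTrace {S : HermMat n} (hS : (toMat S).PosDef) (H K : HermMat n) :
    bwForm S H K = weightedTrace S (solve S H) (solve S K) := by
  rw [bwForm_apply]
  conv_lhs => rw [← anticomm_solve hS K]
  rw [reTr_anticomm]
  ring

theorem bwForm_self_pos {S : HermMat n} (hS : (toMat S).PosDef) {H : HermMat n} (hH : H ≠ 0) :
    0 < bwForm S H H := by
  rw [bwForm_eq_weightedTrace hS]
  refine weightedTrace_self_pos hS fun h => hH ?_
  rw [← anticomm_solve hS H, h, map_zero]

end HermMat

/-- The Bures-Wasserstein Riemannian metric on `ℙ(n)`. -/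
def bwMetric (n : ℕ) : ContMDiffRiemannianMetric 𝓘(ℝ, HermMat n) ∞ (HermMat n)
    (fun S : PosDefMat n => TangentSpace 𝓘(ℝ, HermMat n) S) where
  inner S := bwForm (S : HermMat n)
  symm S H K := by
    refine (bwForm_eq_weightedTrace S.2 H K).trans ?_
    rw [weightedTrace_comm]
    exact (bwForm_eq_weightedTrace S.2 K H).symm
  pos S H hH := bwForm_self_pos S.2 hH
  isVonNBounded S := isVonNBounded_of_bilinear_pos (bwForm (S : HermMat n))
    fun _ => bwForm_self_pos S.2
  contMDiff := by
    refine contMDiff_bilinearForm_opens (PosDefMat n) _ (fun S => bwForm (S : HermMat n))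
      (fun _ _ _ => rfl) fun S => ?_
    have h : ContDiffAt ℝ ∞ (bwForm : HermMat n → _) (S : HermMat n) :=
      contDiffAt_const.clm_comp (contDiffAt_solve S.2)
    exact h.contMDiffAt.comp S contMDiff_subtype_val.contMDiffAt

/-- The Riemannian bundle structure given by the Bures-Wasserstein metric. -/
@[reducible]
def bwBundle (n : ℕ) :
    RiemannianBundle (fun S : PosDefMat n => TangentSpace 𝓘(ℝ, HermMat n) S) :=
  ⟨(bwMetric n).toRiemannianMetric⟩

attribute [local instance] bwBundle

/-! ### Lower bound: no curve is shorter than the distance -/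

theorem enorm_tangentSpace_posDefMat (S : PosDefMat n) (H : TangentSpace 𝓘(ℝ, HermMat n) S) :
    ‖H‖ₑ = ENNReal.ofReal √(bwForm (S : HermMat n) H H) := by
  rw [← ofReal_norm, norm_eq_sqrt_real_inner]
  rfl

theorem hasDerivAt_coe_of_mdifferentiableAt {E : Type*} [NormedAddCommGroup E] [NormedSpace ℝ E]
    {U : TopologicalSpace.Opens E} {γ : ℝ → U} {t : ℝ}
    (hγ : MDifferentiableAt 𝓘(ℝ, ℝ) 𝓘(ℝ, E) γ t) :
    HasDerivAt (F := E) (fun s => (γ s : E)) (mfderiv 𝓘(ℝ, ℝ) 𝓘(ℝ, E) γ t (1 : ℝ) : E) t := by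
  have h := (hasMFDerivAt_subtype_val_opens U (γ t)).comp t hγ.hasMFDerivAt
  have h2 : HasFDerivAt (F := E) (fun s => (γ s : E))
      ((ContinuousLinearMap.id ℝ E).comp (mfderiv 𝓘(ℝ, ℝ) 𝓘(ℝ, E) γ t : ℝ →L[ℝ] E)) t :=
    hasMFDerivAt_iff_hasFDerivAt.1 h
  exact h2.hasDerivAt

/-- Along a `C¹` curve, the regularized distance `√(d(S, ·)² + ε)` grows at most by the length. -/
theorem sqrt_distSq_add_le_pathELength (S T : PosDefMat n) {γ : ℝ → PosDefMat n}
    (h0 : γ 0 = S) (h1 : γ 1 = T)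
    (hγ : ContMDiffOn 𝓘(ℝ, ℝ) 𝓘(ℝ, HermMat n) 1 γ (Set.Icc 0 1)) {ε : ℝ} (hε : 0 < ε) :
    ENNReal.ofReal (√(distSq (S : HermMat n) T + ε) - √ε) ≤
      Manifold.pathELength 𝓘(ℝ, HermMat n) γ 0 1 := by
  -- The distance itself need not be differentiable where the curve meets `S`, as it does at `t =
  -- 0`; adding `ε` keeps the radicand positive.
  let f : ℝ → ℝ := fun t => √(distSq (S : HermMat n) (γ t) + ε)
  have hpos (t : ℝ) : 0 < distSq (S : HermMat n) (γ t) + ε := by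
    linarith [distSq_nonneg S (γ t)]
  have hc : ContDiffOn ℝ 1 (fun t => (γ t : HermMat n)) (Set.Icc 0 1) := by
    rw [← contMDiffOn_iff_contDiffOn]
    exact contMDiff_subtype_val.comp_contMDiffOn hγ
  have hf : ContDiffOn ℝ 1 f (Set.Icc 0 1) := by
    intro t ht
    have h2 := (contDiffAt_distSq S.2 (γ t).2).comp_contDiffWithinAt t (hc t ht)
    exact (h2.add contDiffWithinAt_const).sqrt (hpos t).ne'
  have hle := enorm_sub_le_lintegral_deriv_of_contDiffOn_Icc hf zero_le_one
  have hf0 : f 0 = √ε := by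
    simp only [f, h0, distSq_eq, bwSq_self]
    simp
  have hf1 : f 1 = √(distSq (S : HermMat n) T + ε) := by simp only [f, h1]
  rw [hf0, hf1, Real.enorm_eq_ofReal_abs] at hle
  refine (ENNReal.ofReal_le_ofReal (le_abs_self _)).trans (hle.trans ?_)
  rw [Manifold.pathELength_eq_lintegral_mfderiv_Ioo, ← MeasureTheory.restrict_Ioo_eq_restrict_Icc]
  refine MeasureTheory.setLIntegral_mono' measurableSet_Ioo fun t ht => ?_
  have hmd : MDifferentiableAt 𝓘(ℝ, ℝ) 𝓘(ℝ, HermMat n) γ t :=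
    ((hγ t ⟨ht.1.le, ht.2.le⟩).contMDiffAt (Icc_mem_nhds ht.1 ht.2)).mdifferentiableAt one_ne_zero
  set v : HermMat n := mfderiv 𝓘(ℝ, ℝ) 𝓘(ℝ, HermMat n) γ t (1 : ℝ) with hv
  have hd : HasDerivAt (fun s => (γ s : HermMat n)) v t := hasDerivAt_coe_of_mdifferentiableAt hmd
  have hd2 := (hasFDerivAt_distSq S.2 (γ t).2).comp_hasDerivAt t hd
  have hd3 : HasDerivAt f _ t := (hd2.add_const ε).sqrt (hpos t).ne'
  rw [hd3.deriv, Real.enorm_eq_ofReal_abs, enorm_tangentSpace_posDefMat]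
  refine ENNReal.ofReal_le_ofReal ?_
  change _ ≤ √(bwForm (γ t : HermMat n) v v)
  have hsq : 0 < √(distSq (S : HermMat n) (γ t) + ε) := Real.sqrt_pos.2 (hpos t)
  rw [bwForm_eq_weightedTrace (γ t).2, abs_div]
  change _ / |2 * √(distSq (S : HermMat n) (γ t) + ε)| ≤ _
  rw [abs_of_pos (by positivity : 0 < 2 * √(distSq (S : HermMat n) (γ t) + ε)),
    div_le_iff₀ (by positivity)]
  refine (abs_reTr_le S (γ t) v).trans ?_
  -- The denominator `2 √(d² + ε)` of the derivative absorbs the factor `2 d`.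
  have h3 : √(distSq (S : HermMat n) (γ t)) ≤ √(distSq (S : HermMat n) (γ t) + ε) :=
    Real.sqrt_le_sqrt (by linarith)
  have h4 := Real.sqrt_nonneg (weightedTrace (γ t : HermMat n) (solve (γ t : HermMat n) v)
    (solve (γ t : HermMat n) v))
  calc _ ≤ 2 * (√(distSq (S : HermMat n) (γ t) + ε) * _) := by gcongr
    _ = _ := by ring

/-- Let `ε → 0⁺` in the regularized estimate. -/
theorem bwDist_le_pathELength (S T : PosDefMat n) {γ : ℝ → PosDefMat n}
    (h0 : γ 0 = S) (h1 : γ 1 = T)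
    (hγ : ContMDiffOn 𝓘(ℝ, ℝ) 𝓘(ℝ, HermMat n) 1 γ (Set.Icc 0 1)) :
    ENNReal.ofReal (bwDist S T) ≤ Manifold.pathELength 𝓘(ℝ, HermMat n) γ 0 1 := by
  have hcont : Continuous fun ε : ℝ =>
      ENNReal.ofReal (√(distSq (S : HermMat n) T + ε) - √ε) :=
    ENNReal.continuous_ofReal.comp (by fun_prop)
  have hlim := (hcont.tendsto 0).mono_left (nhdsWithin_le_nhds (s := Set.Ioi 0))
  have hval : ENNReal.ofReal (√(distSq (S : HermMat n) T + 0) - √0) =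
      ENNReal.ofReal (bwDist S T) := by
    rw [add_zero, Real.sqrt_zero, sub_zero, distSq_eq, bwDist]
  rw [← hval]
  refine le_of_tendsto hlim ?_
  filter_upwards [self_mem_nhdsWithin] with ε hε
  exact sqrt_distSq_add_le_pathELength S T h0 h1 hγ hε

/-! ### Upper bound: a constant-speed curve realizing the distance -/

namespace HermMat

/-- The linear map `H ↦ U H V + V H U` on `ℍ(n)`, for Hermitian `U` and `V`. -/
def polarCongruence (U V H : HermMat n) : HermMat n :=
  ofMat (toMat U * toMat H * toMat V + toMat V * toMat H * toMat U) (by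
    simp [Matrix.IsHermitian, mul_assoc, add_comm])

@[simp]
theorem toMat_polarCongruence (U V H : HermMat n) : toMat (polarCongruence U V H) =
    toMat U * toMat H * toMat V + toMat V * toMat H * toMat U :=
  rfl

/-- The curve `t ↦ A T A` with `A = N + t (1 - N)`, expanded in powers of `t`. -/
def congruenceCurve (N T : HermMat n) (t : ℝ) : HermMat n :=
  congruence (toMat N) T + t • polarCongruence (idMat n - N) N T +
    t ^ 2 • congruence (toMat (idMat n - N)) T

/-- The velocity of `congruenceCurve`. -/
def congruenceVelocity (N T : HermMat n) (t : ℝ) : HermMat n :=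
  polarCongruence (idMat n - N) N T + (2 * t) • congruence (toMat (idMat n - N)) T

theorem toMat_congruenceCurve (N T : HermMat n) (t : ℝ) :
    toMat (congruenceCurve N T t) =
      toMat (N + t • (idMat n - N)) * toMat T * toMat (N + t • (idMat n - N)) := by
  simp only [congruenceCurve, toMat_polarCongruence, map_add, map_smul, toMat_congruence,
    conjTranspose_toMat, add_mul, mul_add, smul_mul_assoc, mul_smul_comm, smul_add, smul_smul,
    pow_two]
  abel

theorem toMat_congruenceVelocity (N T : HermMat n) (t : ℝ) :
    toMat (congruenceVelocity N T t) =
      toMat (idMat n - N) * toMat T * toMat (N + t • (idMat n - N)) +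
        toMat (N + t • (idMat n - N)) * toMat T * toMat (idMat n - N) := by
  simp only [congruenceVelocity, toMat_polarCongruence, map_add, map_smul, toMat_congruence,
    conjTranspose_toMat, add_mul, mul_add, smul_mul_assoc, mul_smul_comm, two_mul, add_smul]
  abel

theorem contDiff_congruenceCurve (N T : HermMat n) {k : WithTop ℕ∞} :
    ContDiff ℝ k (congruenceCurve N T) := by
  unfold congruenceCurve
  fun_prop

theorem hasDerivAt_congruenceCurve (N T : HermMat n) (t : ℝ) :
    HasDerivAt (congruenceCurve N T) (congruenceVelocity N T t) t := by
  have h1 := ((hasDerivAt_id t).smul_const (polarCongruence (idMat n - N) N T)).const_add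
    (congruence (toMat N) T)
  have h2 := ((hasDerivAt_id t).pow 2).smul_const (congruence (toMat (idMat n - N)) T)
  refine (h1.add h2).congr_deriv ?_
  simp [congruenceVelocity]

theorem posDef_segment {N : HermMat n} (hN : (toMat N).PosDef) {t : ℝ} (ht : t ∈ Set.Icc 0 1) :
    (toMat (N + t • (idMat n - N))).PosDef := by
  have h : toMat (N + t • (idMat n - N)) = (1 - t) • toMat N + t • 1 := by
    simp only [map_add, map_smul, map_sub, toMat_idMat, smul_sub, sub_smul, one_smul]
    abel
  have h1 : (1 : Matrix (Fin n) (Fin n) ℂ).PosDef := Matrix.PosDef.one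
  rw [h]
  -- For `t < 1` strict positivity comes from `N`; at `t = 1` its coefficient vanishes and the
  -- identity supplies it.
  rcases ht.2.eq_or_lt with rfl | hlt
  · simpa using h1
  · exact (hN.smul (sub_pos.2 hlt)).add_posSemidef (h1.posSemidef.smul ht.1)

theorem posDef_congruenceCurve {N T : HermMat n} (hN : (toMat N).PosDef) (hT : (toMat T).PosDef)
    {t : ℝ} (ht : t ∈ Set.Icc 0 1) : (toMat (congruenceCurve N T t)).PosDef := by
  have h := posDef_congruence hT (posDef_segment hN ht).isUnit
  rwa [toMat_congruence, conjTranspose_toMat, ← toMat_congruenceCurve] at h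

/-- The curve `congruenceCurve` has constant speed for the Bures-Wasserstein metric. -/
theorem bwForm_congruenceVelocity {N T : HermMat n} (hN : (toMat N).PosDef)
    (hT : (toMat T).PosDef) {t : ℝ} (ht : t ∈ Set.Icc 0 1) :
    bwForm (congruenceCurve N T t) (congruenceVelocity N T t) (congruenceVelocity N T t) =
      weightedTrace T (idMat n - N) (idMat n - N) := by
  have hA := posDef_segment hN ht
  have hdet := (Matrix.isUnit_iff_isUnit_det _).1 hA.isUnit
  have hc := toMat_congruenceCurve N T t
  have hv := toMat_congruenceVelocity N T t
  -- Both factors are polynomials in `N`.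
  have hcomm : toMat (idMat n - N) * toMat (N + t • (idMat n - N)) =
      toMat (N + t • (idMat n - N)) * toMat (idMat n - N) := by
    simp only [map_add, map_smul, map_sub, toMat_idMat, mul_add, add_mul, mul_smul_comm,
      smul_mul_assoc, mul_sub, sub_mul, one_mul, mul_one, smul_sub]
    abel
  set A := toMat (N + t • (idMat n - N))
  set U := toMat (idMat n - N) with hU
  have hl : A⁻¹ * A = 1 := Matrix.nonsing_inv_mul _ hdet
  have hr : A * A⁻¹ = 1 := Matrix.mul_nonsing_inv _ hdet
  have hcomm' : U * A⁻¹ = A⁻¹ * U := by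
    calc U * A⁻¹ = A⁻¹ * A * U * A⁻¹ := by rw [hl, one_mul]
      _ = A⁻¹ * (U * A) * A⁻¹ := by rw [hcomm]; simp only [mul_assoc]
      _ = A⁻¹ * U := by rw [mul_assoc, mul_assoc, hr, mul_one]
  have hAH : A⁻¹.conjTranspose = A⁻¹ := hA.isHermitian.inv
  -- The Lyapunov solution for the velocity: `X = A⁻¹ U = U A⁻¹` is Hermitian, and `(A T A) X + X (A
  -- T A) = A T U + U T A`.
  let X : HermMat n := ofMat (A⁻¹ * U) (by
    rw [Matrix.IsHermitian, Matrix.conjTranspose_mul, hAH, hU, conjTranspose_toMat, ← hU, hcomm'])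
  have hX : solve (congruenceCurve N T t) (congruenceVelocity N T t) = X := by
    rw [← solve_anticomm (posDef_congruenceCurve hN hT ht) X]
    congr 1
    apply toMat_injective
    rw [toMat_anticomm, hc, hv, toMat_ofMat, add_comm]
    congr 1
    · rw [mul_assoc _ A, ← mul_assoc A, hr, one_mul]
    · rw [← hcomm', mul_assoc U A⁻¹, ← mul_assoc A⁻¹ (A * toMat T), ← mul_assoc A⁻¹ A, hl,
        one_mul, mul_assoc]
  rw [bwForm_eq_weightedTrace (posDef_congruenceCurve hN hT ht), hX, weightedTrace_apply,
    weightedTrace_apply, hc, ← hU, toMat_ofMat]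
  congr 2
  calc A⁻¹ * U * (A * toMat T * A) * (A⁻¹ * U)
      = U * (A⁻¹ * A) * toMat T * (A * A⁻¹) * U := by
        nth_rw 1 [← hcomm']
        simp only [mul_assoc]
    _ = U * toMat T * U := by rw [hl, hr, mul_one, mul_one]

end HermMat

/-- The distance is realized by the curve `t ↦ A T A` with `A = (1 - t) N + t`. -/
theorem riemannianEDist_le_bwDist (S T : PosDefMat n) :
    Manifold.riemannianEDist 𝓘(ℝ, HermMat n) S T ≤ ENNReal.ofReal (bwDist S T) := by
  classical
  let N := transport (S : HermMat n) T
  have hN : (toMat N).PosDef := posDef_transport S.2 T.2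
  let c := congruenceCurve N (T : HermMat n)
  -- Outside `[0, 1]` the curve may leave the cone; the default value `S` is never taken on `[0,
  -- 1]`.
  let γ : ℝ → PosDefMat n := fun t => if h : (toMat (c t)).PosDef then ⟨c t, h⟩ else S
  have hγc {t : ℝ} (ht : t ∈ Set.Icc (0 : ℝ) 1) : (γ t : HermMat n) = c t := by
    have h := posDef_congruenceCurve hN T.2 ht
    exact congrArg Subtype.val (dif_pos h)
  have h0 : γ 0 = S := by
    refine Subtype.ext ((hγc (by simp)).trans (toMat_injective ?_))
    rw [toMat_congruenceCurve, zero_smul, add_zero]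
    exact transport_mul_mul_transport S.2 T.2
  have h1 : γ 1 = T := by
    refine Subtype.ext ((hγc (by simp)).trans (toMat_injective ?_))
    rw [toMat_congruenceCurve, one_smul, add_sub_cancel, toMat_idMat, one_mul, mul_one]
  have hγ : ContMDiffOn 𝓘(ℝ, ℝ) 𝓘(ℝ, HermMat n) 1 γ (Set.Icc 0 1) := by
    have h : ContMDiffOn 𝓘(ℝ, ℝ) 𝓘(ℝ, HermMat n) ∞ γ (Set.Icc 0 1) := by
      intro t ht
      rw [← ContMDiffWithinAt.subtypeVal_comp_iff]
      exact ((contDiff_congruenceCurve N T).contMDiff.contMDiffOn.congr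
        fun s hs => hγc hs) t ht
    exact h.of_le (by exact_mod_cast le_top)
  refine (Manifold.riemannianEDist_le_pathELength hγ h0 h1 zero_le_one).trans ?_
  rw [Manifold.pathELength_eq_lintegral_mfderiv_Ioo]
  have hspeed (t : ℝ) (ht : t ∈ Set.Ioo (0 : ℝ) 1) :
      ‖mfderiv 𝓘(ℝ, ℝ) 𝓘(ℝ, HermMat n) γ t (1 : ℝ)‖ₑ = ENNReal.ofReal (bwDist S T) := by
    have ht' : t ∈ Set.Icc (0 : ℝ) 1 := ⟨ht.1.le, ht.2.le⟩
    have hnhds := Icc_mem_nhds ht.1 ht.2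
    have hmd : MDifferentiableAt 𝓘(ℝ, ℝ) 𝓘(ℝ, HermMat n) γ t :=
      ((hγ t ht').contMDiffAt hnhds).mdifferentiableAt one_ne_zero
    have hd := hasDerivAt_coe_of_mdifferentiableAt hmd
    have hd' : HasDerivAt (fun s => (γ s : HermMat n)) (congruenceVelocity N T t) t :=
      (hasDerivAt_congruenceCurve N T t).congr_of_eventuallyEq
        (Filter.eventuallyEq_of_mem hnhds fun s hs => hγc hs)
    rw [enorm_tangentSpace_posDefMat, bwDist, bwSq_re_eq_weightedTrace,
      ← bwForm_congruenceVelocity hN T.2 ht', hγc ht', hd.unique hd']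
  refine (MeasureTheory.setLIntegral_congr_fun measurableSet_Ioo hspeed).le.trans ?_
  simp

theorem riemannianEDist_eq_bwDist (S T : PosDefMat n) :
    Manifold.riemannianEDist 𝓘(ℝ, HermMat n) S T = ENNReal.ofReal (bwDist S T) := by
  refine le_antisymm (riemannianEDist_le_bwDist S T) (le_of_forall_gt fun r hr => ?_)
  obtain ⟨γ, h0, h1, hγ, hlen⟩ := Manifold.exists_lt_of_riemannianEDist_lt hr
  exact (bwDist_le_pathELength S T h0 h1 hγ).trans_lt hlen

theorem theorem2p4 (n : ℕ) :
    (∀ S T : PosDefMat n, (bwSq S T).im = 0 ∧ 0 ≤ (bwSq S T).re) ∧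
    ∃ g : ContMDiffRiemannianMetric 𝓘(ℝ, HermMat n) ∞ (HermMat n)
        (fun S : PosDefMat n => TangentSpace 𝓘(ℝ, HermMat n) S),
      (∀ (S : PosDefMat n) (H K : HermMat n),
        g.inner S H K = (lyapunov S H.toMat * (matOf S) * lyapunov S K.toMat).trace.re ∧
        g.inner S H K = 1 / 2 * (lyapunov S H.toMat * K.toMat).trace.re) ∧
      ∀ S T : PosDefMat n, riemDist g S T = ENNReal.ofReal (bwDist S T) := by
  refine ⟨fun S T => ?_, bwMetric n, fun S H K => ⟨?_, ?_⟩, riemannianEDist_eq_bwDist⟩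
  · have h := Complex.nonneg_iff.1 (bwSq_nonneg S T)
    exact ⟨h.2.symm, h.1⟩
  · rw [lyapunov_toMat, lyapunov_toMat]
    exact bwForm_eq_weightedTrace S.2 H K
  · rw [lyapunov_toMat]
    rfl

end
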